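/- Time axis and behaviors. A behavior with signal space $\mathbb{R}^{\mathrm w}$ is a set $\mathfrak{B}$ of trajectories $w:\mathbb{Z}_{\ge 0}\to\mathbb{R}^{\mathrm w}$. For $a\le b$ let $\hat w_{[a,b]}=\mathrm{col}(w(a),\dots,w(b))$ and $\mathfrak{B}_{[a,b]}=\{\hat w_{[a,b]} : w\in\mathfrak{B}\}$. $\mathfrak{B}$ is LTI if it is a linear subspace of $(\mathbb{R}^{\mathrm w})^{\mathbb{Z}_{\ge0}}$, closed under pointwise convergence, with $\sigma\mathfrak{B}\subset\mathfrak{B}$, where $(\sigma w)(k)=w(k+1)$. Its lag $\mathtt{L}(\mathfrak{B})$ is the smallest integer $\ell\ge 0$ such that every $w$ with $\hat w_{[k,k+\ell]}\in\mathfrak{B}_{[k,k+\ell]}$ for all $k\ge0$ belongs to $\mathfrak{B}$. Quadratic difference forms. A QdF of order $K_\Phi$ is given by matrices $\Phi_{pq}\in\mathbb{R}^{\mathrm w\times\mathrm w}$, $0\le p,q\le K_\Phi$, with $\Phi_{qp}=\Phi_{pq}^\top$; for $k\ge K_\Phi$, $$Q_\Phi(w)(k)=\sum_{p=0}^{K_\Phi}\sum_{q=0}^{K_\Phi}w(k-p)^\top\Phi_{pq}\,w(k-q)=\hat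 w_{[k-K_\Phi,k]}^\top\widetilde\Phi\,\hat w_{[k-K_\Phi,k]},\qquad \widetilde\Phi=\begin{bmatrix}\Phi_{K_\Phi K_\Phi}&\cdots&\Phi_{K_\Phi0}\\ \vdots&&\vdots\\ \Phi_{0K_\Phi}&\cdots&\Phi_{00}\end{bmatrix}.$$ Dissipativity. Given QdFs $Q_\Phi$ (supply rate) and $Q_\Psi$ (storage), let $\mathfrak{B}_{ps}$ be the set of all $(w,s,V)$ with $w\in\mathfrak{B}$, $s:\mathbb{Z}_{\ge0}\to\mathbb{R}$, $V:\mathbb{Z}_{\ge0}\to\mathbb{R}_{\ge0}$, such that $V(k)-V(k-1)\le s(k)$ for all $k\ge1$, $s(k)=Q_\Phi(w)(k)$ for all $k\ge K_\Phi$ and $V(k)=Q_\Psi(w)(k)$ for all $k\ge K_\Psi$. $\mathfrak{B}$ is called $(Q_\Phi,Q_\Psi)$-dissipative if $\mathfrak{B}=\pi_w(\mathfrak{B}_{ps})$, where $\pi_w$ is the projection $(w,s,V)\mapsto w$. Proposition. Let $\mathfrak{B}$ be LTI and let $Q_\Phi,Q_\Psi$ be QdFs of orders $K_\Phi,K_\Psi$.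 Put $L^-=\max\{K_\Phi,K_\Psi+1\}$, let $L^+\ge0$ be an integer, $L=L^-+L^++1$, and let $\mathcal{F}$ be a real matrix with $L\mathrm w$ rows whose column span is the $L$-step behavior $\mathfrak{B}_{[0,L-1]}$. For $0\le l\le L^+$ let $\mathcal{F}_l$ be the submatrix of $\mathcal{F}$ formed by the block rows of the steps $l,\dots,l+L^-$. Let $$\nabla\widetilde\Psi=\mathrm{diag}(0_{\mathrm w},\widetilde\Psi)-\mathrm{diag}(\widetilde\Psi,0_{\mathrm w}),\quad \widehat\Phi=\mathrm{diag}(0_{(L^--K_\Phi)\mathrm w},\widetilde\Phi),\quad \nabla\widehat\Psi=\mathrm{diag}(0_{(L^--K_\Psi-1)\mathrm w},\nabla\widetilde\Psi).$$ Assume $L^->\mathtt{L}(\mathfrak{B})$ and $\widetilde\Psi\ge0$ (positive semidefinite). If $$z^\top\mathcal{F}_l^\top(\widehat\Phi-\nabla\widehat\Psi)\mathcal{F}_l z\ge0\qquad\text{for all } l\in\{0,\dots,L^+\}\text{ and all } z, \tag{1}$$ then $\mathfrak{B}$ is $(Q_\Phi,Q_\Psi)$-dissipative, i.e. $\mathfrak{B}=\pi_w(\mathfrak{B}_{ps})$.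 Furthermore, if $L^+=0$, then condition (1) is equivalent to the single linear matrix inequality $\mathcal{F}^\top(\widehat\Phi-\nabla\widehat\Psi)\mathcal{F}\ge0$. -/

import Mathlib

/-- A behavior with signal space `W` on the time axis `ℕ`: a set of trajectories. -/
abbrev Behavior (W : Type*) := Set (ℕ → W)

namespace Behavior

variable {W W₁ W₂ : Type*}

/-- The segment `(w(a), w(a+1), …, w(a+n-1))` of a trajectory, of length `n`. -/
def seg (w : ℕ → W) (a n : ℕ) : Fin n → W := fun i => w (a + i)

/-- The behavior restricted to the interval `[a, a+n-1]`. -/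
def restrict (B : Behavior W) (a n : ℕ) : Set (Fin n → W) := (fun w => seg w a n) '' B

/-- `σB ⊆ B`, where `(σw)(k) = w(k+1)`. -/
def IsTimeInvariant (B : Behavior W) : Prop := ∀ w ∈ B, (fun k => w (k + 1)) ∈ B

/-- The lag: the smallest `ℓ` such that `w|[k,k+ℓ] ∈ B|[k,k+ℓ]` for all times `k` implies `w ∈ B`
(and `⊤` if there is no such `ℓ`). -/
noncomputable def lag (B : Behavior W) : ℕ∞ :=
  ⨅ ℓ ∈ {ℓ : ℕ | ∀ w : ℕ → W, (∀ k, seg w k (ℓ + 1) ∈ B.restrict k (ℓ + 1)) → w ∈ B}, (ℓ : ℕ∞)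

/-- Linear time-invariant behaviors: shift-invariant linear subspaces of `(ℝ^d)^ℕ` that are closed
in the topology of pointwise convergence. -/
structure IsLTI {d : ℕ} (B : Behavior (Fin d → ℝ)) : Prop where
  linear : ∃ S : Submodule ℝ (ℕ → Fin d → ℝ), (S : Set (ℕ → Fin d → ℝ)) = B
  closed : IsClosed B
  timeInvariant : B.IsTimeInvariant

/-- The product `B₁ × B₂` of two behaviors, with trajectories `k ↦ (w₁(k), w₂(k))`. -/
def times (B₁ : Behavior W₁) (B₂ : Behavior W₂) : Behavior (W₁ × W₂) :=
  {v | (fun k => (v k).1) ∈ B₁ ∧ (fun k => (v k).2) ∈ B₂}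

/-- The projection of a behavior on its first variable. -/
def projFst (B : Behavior (W₁ × W₂)) : Behavior W₁ := (fun v k => (v k).1) '' B

end Behavior

/-- Stacking of a finite trajectory into one column vector `col(w(1), …, w(n))`. -/
def stack {n d : ℕ} (u : Fin n → Fin d → ℝ) : Fin n × Fin d → ℝ := fun p => u p.1 p.2

/-- The space of square matrices acting on stacked trajectories with `n` steps in `ℝ^d`. -/
abbrev TrajMatrix (n d : ℕ) := Matrix (Fin n × Fin d) (Fin n × Fin d) ℝ

namespace TrajMatrix

variable {d : ℕ}

/-- The block diagonal matrix `diag(A, B)`. -/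
def diag {m n : ℕ} (A : TrajMatrix m d) (B : TrajMatrix n d) : TrajMatrix (m + n) d :=
  let e : (Fin m × Fin d) ⊕ (Fin n × Fin d) ≃ Fin (m + n) × Fin d :=
    (Equiv.sumProdDistrib (Fin m) (Fin n) (Fin d)).symm.trans
      (Equiv.prodCongr finSumFinEquiv (Equiv.refl (Fin d)))
  Matrix.reindex e e (Matrix.fromBlocks A 0 0 B)

/-- The same matrix, with the number of steps rewritten along an equality. -/
def cast {m n : ℕ} (h : m = n) (A : TrajMatrix m d) : TrajMatrix n d :=
  Matrix.reindex ((finCongr h).prodCongr (Equiv.refl (Fin d)))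
    ((finCongr h).prodCongr (Equiv.refl (Fin d))) A

end TrajMatrix

/-- A quadratic difference form on trajectories in `ℝ^d`: an order `K` and coefficient blocks
`Φ_{pq}`, `0 ≤ p, q ≤ K`, with `Φ_{qp} = Φ_{pq}ᵀ`. -/
structure QdF (d : ℕ) where
  order : ℕ
  coef : Fin (order + 1) → Fin (order + 1) → Matrix (Fin d) (Fin d) ℝ
  symm : ∀ p q, coef q p = (coef p q).transpose

namespace QdF

open Matrix

variable {d : ℕ}

/-- `Q_Φ(w)(k) = ∑_{p,q} w(k-p)ᵀ Φ_{pq} w(k-q)`; it is meaningful (and only used) at times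
`k ≥ K_Φ`, where all of `k-p`, `k-q` belong to the time axis. -/
def eval (Φ : QdF d) (w : ℕ → Fin d → ℝ) (k : ℕ) : ℝ :=
  ∑ p : Fin (Φ.order + 1), ∑ q : Fin (Φ.order + 1),
    w (k - (p : ℕ)) ⬝ᵥ (Φ.coef p q *ᵥ w (k - (q : ℕ)))

/-- The coefficient matrix `Φ̃`, with blocks `Φ_{KK}, …, Φ_{K0}` in the first block row and
`Φ_{0K}, …, Φ_{00}` in the last one. -/
def tilde (Φ : QdF d) : TrajMatrix (Φ.order + 1) d :=
  fun i j => Φ.coef i.1.rev j.1.rev i.2 j.2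

/-- `∇Ψ̃ = diag(0_d, Ψ̃) - diag(Ψ̃, 0_d)`. -/
def nabla (Ψ : QdF d) : TrajMatrix (Ψ.order + 2) d :=
  TrajMatrix.cast (Nat.add_comm 1 (Ψ.order + 1))
      (TrajMatrix.diag (0 : TrajMatrix 1 d) Ψ.tilde) -
    TrajMatrix.diag Ψ.tilde (0 : TrajMatrix 1 d)

/-- `L⁻ = max {K_Φ, K_Ψ + 1}`. -/
def past (Φ Ψ : QdF d) : ℕ := max Φ.order (Ψ.order + 1)

/-- `Φ̂ = diag(0_{k_Φ d}, Φ̃)` with `k_Φ = L⁻ - K_Φ`. -/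
def supplyHat (Φ Ψ : QdF d) : TrajMatrix (past Φ Ψ + 1) d :=
  TrajMatrix.cast (by unfold past; omega)
    (TrajMatrix.diag (0 : TrajMatrix (past Φ Ψ - Φ.order) d) Φ.tilde)

/-- `∇Ψ̂ = diag(0_{k_Ψ d}, ∇Ψ̃)` with `k_Ψ = L⁻ - K_Ψ - 1`. -/
def nablaHat (Φ Ψ : QdF d) : TrajMatrix (past Φ Ψ + 1) d :=
  TrajMatrix.cast (by unfold past; omega)
    (TrajMatrix.diag (0 : TrajMatrix (past Φ Ψ - Ψ.order - 1) d) Ψ.nabla)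

end QdF

/-- The dissipative behavior with variables `(s, V)`: `V ≥ 0` and `V(k) - V(k-1) ≤ s(k)` for all
times `k` such that `k - 1` is a time. -/
def dissBehavior : Behavior (ℝ × ℝ) :=
  {v | (∀ k, 0 ≤ (v k).2) ∧ ∀ k, 1 ≤ k → (v k).2 - (v (k - 1)).2 ≤ (v k).1}

/-- The interconnection behavior, with variables `(w, (s, V))`: `s(k) = Q_Φ(w)(k)` and
`V(k) = Q_Ψ(w)(k)` at all times `k` at which the respective form is defined. -/
def networkBehavior {d : ℕ} (Φ Ψ : QdF d) : Behavior ((Fin d → ℝ) × (ℝ × ℝ)) :=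
  {v | (∀ k, Φ.order ≤ k → (v k).2.1 = Φ.eval (fun i => (v i).1) k) ∧
    (∀ k, Ψ.order ≤ k → (v k).2.2 = Ψ.eval (fun i => (v i).1) k)}

/-- The interconnection `(B × B_{sV}) ∩ B_s^Π` of `B` with the dissipative behavior. -/
def dissInterconnection {d : ℕ} (B : Behavior (Fin d → ℝ)) (Φ Ψ : QdF d) :
    Behavior ((Fin d → ℝ) × (ℝ × ℝ)) :=
  B.times dissBehavior ∩ networkBehavior Φ Ψ

/-- `B` is `(Q_Φ, Q_Ψ)`-dissipative: it coincides with its `(Q_Φ, Q_Ψ)`-dissipative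
sub-behavior. -/
def IsDissipative {d : ℕ} (B : Behavior (Fin d → ℝ)) (Φ Ψ : QdF d) : Prop :=
  B = (dissInterconnection B Φ Ψ).projFst

/-- The rows of `F` that belong to the steps `l, …, l+m` of a trajectory with steps
`0, …, m+n`. -/
def window {m n d r : ℕ} (F : Matrix (Fin (m + n + 1) × Fin d) (Fin r) ℝ) (l : Fin (n + 1)) :
    Matrix (Fin (m + 1) × Fin d) (Fin r) ℝ :=
  fun i j => F (⟨l + i.1, by omega⟩, i.2) j

/-- The same matrix, with the number of steps rewritten along an equality. -/
def castRows {m n d r : ℕ} (h : m = n) (F : Matrix (Fin m × Fin d) (Fin r) ℝ) :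
    Matrix (Fin n × Fin d) (Fin r) ℝ :=
  fun i j => F (Fin.cast h.symm i.1, i.2) j

/-! The form of $\widehat\Phi-\nabla\widehat\Psi$ on a window of $L^-+1$ steps ending at time $k$
equals $Q_\Phi(w)(k)-(Q_\Psi(w)(k)-Q_\Psi(w)(k-1))$ (`quad_supplyHat`, `quad_nablaHat`). By shift
invariance, every such window of a trajectory in $\mathfrak{B}$ is an initial window of another one,
hence of the form $\mathcal{F}_0z$. So (1) at $l=0$ already gives the dissipation inequality for all
$k\ge L^-$. At earlier times $s(k)$ or $V(k-1)$ is still free and can be chosen to satisfy the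
inequality (`isDissipative_of_forall_eval`). -/

open Matrix in
/-- The quadratic form of a matrix, evaluated on a segment of a trajectory. -/
def TrajMatrix.quad {n d : ℕ} (A : TrajMatrix n d) (w : ℕ → Fin d → ℝ) (a : ℕ) : ℝ :=
  stack (Behavior.seg w a n) ⬝ᵥ (A *ᵥ stack (Behavior.seg w a n))

namespace TrajMatrix

open Matrix

variable {d : ℕ}

lemma quad_eq_sum {n : ℕ} (A : TrajMatrix n d) (w : ℕ → Fin d → ℝ) (a : ℕ) :
    A.quad w a = ∑ p : Fin n × Fin d, ∑ q : Fin n × Fin d,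
      w (a + p.1) p.2 * (A p q * w (a + q.1) q.2) := by
  simp only [quad, dotProduct, mulVec, Finset.mul_sum, stack, Behavior.seg]

@[simp] lemma quad_zero {n : ℕ} (w : ℕ → Fin d → ℝ) (a : ℕ) :
    (0 : TrajMatrix n d).quad w a = 0 := by
  simp [quad]

lemma quad_sub {n : ℕ} (A C : TrajMatrix n d) (w : ℕ → Fin d → ℝ) (a : ℕ) :
    TrajMatrix.quad (A - C) w a = A.quad w a - C.quad w a := by
  simp [quad, sub_mulVec]

lemma quad_cast {m n : ℕ} (h : m = n) (A : TrajMatrix m d) (w : ℕ → Fin d → ℝ) (a : ℕ) :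
    (cast h A).quad w a = A.quad w a := by
  subst h
  rfl

lemma quad_diag {m n : ℕ} (A : TrajMatrix m d) (C : TrajMatrix n d) (w : ℕ → Fin d → ℝ)
    (a : ℕ) : (diag A C).quad w a = A.quad w a + C.quad w (a + m) := by
  let e : (Fin m × Fin d) ⊕ (Fin n × Fin d) ≃ Fin (m + n) × Fin d :=
    (Equiv.sumProdDistrib (Fin m) (Fin n) (Fin d)).symm.trans
      (Equiv.prodCongr finSumFinEquiv (Equiv.refl (Fin d)))
  have hA : ∀ p q, diag A C (e p) (e q) = fromBlocks A 0 0 C p q := fun p q => by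
    change fromBlocks A 0 0 C (e.symm (e p)) (e.symm (e q)) = _
    rw [e.symm_apply_apply, e.symm_apply_apply]
  simp only [quad_eq_sum, ← e.sum_comp, hA, Fintype.sum_sum_type]
  simp [e, add_assoc]

lemma isSymm_diag {m n : ℕ} {A : TrajMatrix m d} {C : TrajMatrix n d} (hA : A.IsSymm)
    (hC : C.IsSymm) : Matrix.IsSymm (diag A C) :=
  (hA.fromBlocks (by simp) hC).submatrix _

lemma isSymm_cast {m n : ℕ} (h : m = n) {A : TrajMatrix m d} (hA : A.IsSymm) :
    Matrix.IsSymm (cast h A) :=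
  hA.submatrix _

end TrajMatrix

namespace QdF

open Matrix

variable {d : ℕ}

lemma isSymm_tilde (Φ : QdF d) : Φ.tilde.IsSymm := by
  ext i j
  simp [tilde, Φ.symm i.1.rev j.1.rev]

lemma quad_tilde (Φ : QdF d) (w : ℕ → Fin d → ℝ) (a : ℕ) :
    Φ.tilde.quad w a = Φ.eval w (a + Φ.order) := by
  have hk : ∀ p : Fin (Φ.order + 1), a + Φ.order - (p : ℕ) = a + (p.rev : ℕ) := fun p => by
    rw [Fin.val_rev]; omega
  simp only [TrajMatrix.quad_eq_sum, eval, Fintype.sum_prod_type, hk, dotProduct, mulVec,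
    Finset.mul_sum, tilde]
  -- Coefficients are indexed by delay, positions in the window by time; reversal converts one into
  -- the other.
  rw [← Equiv.sum_comp Fin.revPerm]
  refine Finset.sum_congr rfl fun p _ => ?_
  rw [Finset.sum_comm, ← Equiv.sum_comp Fin.revPerm]
  simp

/-- A leading zero block delays the window seen by $\widetilde\Psi$ by one step; a trailing one
leaves its start in place. -/
lemma quad_nabla (Ψ : QdF d) (w : ℕ → Fin d → ℝ) (a : ℕ) :
    Ψ.nabla.quad w a = Ψ.eval w (a + Ψ.order + 1) - Ψ.eval w (a + Ψ.order) := by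
  simp only [nabla, TrajMatrix.quad_sub, TrajMatrix.quad_cast, TrajMatrix.quad_diag,
    TrajMatrix.quad_zero, quad_tilde, zero_add, add_zero, add_right_comm]

/-- Padding in front aligns the form with the end of the common window. -/
lemma quad_supplyHat (Φ Ψ : QdF d) (w : ℕ → Fin d → ℝ) (a : ℕ) :
    (supplyHat Φ Ψ).quad w a = Φ.eval w (a + past Φ Ψ) := by
  have h : a + (past Φ Ψ - Φ.order) + Φ.order = a + past Φ Ψ := by unfold past; omega
  simp only [supplyHat, TrajMatrix.quad_cast, TrajMatrix.quad_diag, TrajMatrix.quad_zero,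
    quad_tilde, zero_add, h]

lemma quad_nablaHat (Φ Ψ : QdF d) (w : ℕ → Fin d → ℝ) (a : ℕ) :
    (nablaHat Φ Ψ).quad w a = Ψ.eval w (a + past Φ Ψ) - Ψ.eval w (a + past Φ Ψ - 1) := by
  have h : a + (past Φ Ψ - Ψ.order - 1) + Ψ.order = a + past Φ Ψ - 1 := by unfold past; omega
  have h' : a + past Φ Ψ - 1 + 1 = a + past Φ Ψ := by unfold past; omega
  simp only [nablaHat, TrajMatrix.quad_cast, TrajMatrix.quad_diag, TrajMatrix.quad_zero,
    quad_nabla, zero_add, h, h']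

lemma isSymm_supplyHat_sub_nablaHat (Φ Ψ : QdF d) :
    Matrix.IsSymm (supplyHat Φ Ψ - nablaHat Φ Ψ) :=
  (TrajMatrix.isSymm_cast _ (TrajMatrix.isSymm_diag isSymm_zero Φ.isSymm_tilde)).sub
    (TrajMatrix.isSymm_cast _ (TrajMatrix.isSymm_diag isSymm_zero
      ((TrajMatrix.isSymm_cast _ (TrajMatrix.isSymm_diag isSymm_zero Ψ.isSymm_tilde)).sub
        (TrajMatrix.isSymm_diag Ψ.isSymm_tilde isSymm_zero))))

lemma eval_nonneg {Ψ : QdF d} (hΨ : Ψ.tilde.PosSemidef) (w : ℕ → Fin d → ℝ) {k : ℕ}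
    (hk : Ψ.order ≤ k) : 0 ≤ Ψ.eval w k := by
  obtain ⟨a, rfl⟩ := Nat.exists_eq_add_of_le' hk
  rw [← quad_tilde]
  simpa [TrajMatrix.quad] using hΨ.dotProduct_mulVec_nonneg (stack (Behavior.seg w a _))

/-- The bound on `k` keeps the subtractions `k - p` from truncating. -/
lemma eval_shift (Φ : QdF d) (w : ℕ → Fin d → ℝ) (a : ℕ) {k : ℕ} (hk : Φ.order ≤ k) :
    Φ.eval (fun i => w (i + a)) k = Φ.eval w (k + a) := by
  have h : ∀ p : Fin (Φ.order + 1), k - (p : ℕ) + a = k + a - p := fun p => by omega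
  simp only [eval, h]

end QdF

lemma Behavior.IsTimeInvariant.shift_mem {W : Type*} {B : Behavior W} (hB : B.IsTimeInvariant)
    {w : ℕ → W} (hw : w ∈ B) (a : ℕ) : (fun k => w (k + a)) ∈ B := by
  induction a with
  | zero => exact hw
  | succ a ih => simpa only [add_assoc, add_comm 1 a] using hB _ ih

/-- A behavior is dissipative as soon as storage is nonnegative and the dissipation inequality
holds at all times at which both `Q_Φ` and the increment of `Q_Ψ` are defined: the free initial
values of `s` and `V` can be filled in backwards in time. -/
lemma isDissipative_of_forall_eval {d : ℕ} {B : Behavior (Fin d → ℝ)} {Φ Ψ : QdF d}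
    (hnonneg : ∀ w ∈ B, ∀ k, Ψ.order ≤ k → 0 ≤ Ψ.eval w k)
    (hdiss : ∀ w ∈ B, ∀ k, QdF.past Φ Ψ ≤ k → Ψ.eval w k - Ψ.eval w (k - 1) ≤ Φ.eval w k) :
    IsDissipative B Φ Ψ := by
  refine Set.Subset.antisymm (fun w hw => ?_) ?_
  -- Going backwards from $K_\Psi$, $V$ grows by $|Q_\Phi(w)(k)|$ per step, so that
  -- $V(k)-V(k-1)=-|Q_\Phi(w)(k)|$ for $1\le k\le K_\Psi$.
  · let V : ℕ → ℝ := fun k => if Ψ.order ≤ k then Ψ.eval w k else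
      Ψ.eval w Ψ.order + ∑ i ∈ Finset.Ioc k Ψ.order, |Φ.eval w i|
    let s : ℕ → ℝ := fun k => if Φ.order ≤ k then Φ.eval w k else V k
    have hV : ∀ k ≤ Ψ.order, V k =
        Ψ.eval w Ψ.order + ∑ i ∈ Finset.Ioc k Ψ.order, |Φ.eval w i| := by
      intro k hk
      rcases hk.eq_or_lt with rfl | hk
      · simp [V]
      · simp [V, hk.not_ge]
    have hV0 : ∀ k, 0 ≤ V k := by
      intro k
      rcases le_total Ψ.order k with hk | hk
      · simpa only [V, if_pos hk] using hnonneg w hw k hk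
      · rw [hV k hk]
        exact add_nonneg (hnonneg w hw _ le_rfl) (Finset.sum_nonneg fun i _ => abs_nonneg _)
    refine ⟨fun k => (w k, s k, V k), ⟨⟨hw, hV0, fun k hk => ?_⟩, fun k hk => if_pos hk,
      fun k hk => if_pos hk⟩, rfl⟩
    change V k - V (k - 1) ≤ s k
    by_cases hΦ : Φ.order ≤ k
    · rw [show s k = Φ.eval w k from if_pos hΦ]
      by_cases hk' : k ≤ Ψ.order
      · have hIoc : Finset.Ioc (k - 1) Ψ.order = insert k (Finset.Ioc k Ψ.order) := by
          ext i
          simp only [Finset.mem_Ioc, Finset.mem_insert]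
          omega
        rw [hV k hk', hV (k - 1) (by omega), hIoc, Finset.sum_insert (by simp)]
        linarith [neg_abs_le (Φ.eval w k)]
      -- Here $k\ge K_\Phi$ and $k\ge K_\Psi+1$, that is, $k\ge L^-$.
      · simpa only [V, if_pos (show Ψ.order ≤ k by omega),
          if_pos (show Ψ.order ≤ k - 1 by omega)] using
          hdiss w hw k (by unfold QdF.past; omega)
    -- The supply is free here; with $s(k)=V(k)$ only $V(k-1)\ge0$ is needed.
    · rw [show s k = V k from if_neg hΦ]
      linarith [hV0 (k - 1)]
  · rintro _ ⟨v, hv, rfl⟩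
    exact hv.1.1

open Matrix in
lemma dotProduct_congruence_mulVec {m r : Type*} [Fintype m] [Fintype r] (M : Matrix m m ℝ)
    (G : Matrix m r ℝ) (z : r → ℝ) :
    z ⬝ᵥ ((Gᵀ * M * G) *ᵥ z) = (G *ᵥ z) ⬝ᵥ (M *ᵥ (G *ᵥ z)) := by
  rw [← mulVec_mulVec, ← mulVec_mulVec, dotProduct_mulVec, vecMul_transpose]

open Matrix in
-- `PosSemidef` includes symmetry, which a nonnegative real quadratic form does not force; it is
-- inherited from `M`.
lemma Matrix.IsSymm.posSemidef_congruence_iff {m r : Type*} [Fintype m] [Fintype r]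
    {M : Matrix m m ℝ} (hM : M.IsSymm) (G : Matrix m r ℝ) :
    (Gᵀ * M * G).PosSemidef ↔ ∀ z : r → ℝ, 0 ≤ z ⬝ᵥ ((Gᵀ * M * G) *ᵥ z) := by
  have hsymm : (Gᵀ * M * G).IsHermitian := by
    rw [IsHermitian, conjTranspose_eq_transpose_of_trivial]
    simp [transpose_mul, hM.eq, Matrix.mul_assoc]
  exact ⟨fun h z => by simpa using h.dotProduct_mulVec_nonneg z,
    fun h => .of_dotProduct_mulVec_nonneg hsymm (by simpa using h)⟩

theorem mainTheorem4 {d r : ℕ} (B : Behavior (Fin d → ℝ)) (hB : B.IsLTI)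
    (Φ Ψ : QdF d) (Lplus : ℕ)
    (F : Matrix (Fin (QdF.past Φ Ψ + Lplus + 1) × Fin d) (Fin r) ℝ)
    (hF : stack '' B.restrict 0 (QdF.past Φ Ψ + Lplus + 1) =
      (LinearMap.range F.mulVecLin : Set (Fin (QdF.past Φ Ψ + Lplus + 1) × Fin d → ℝ)))
    (hlag : B.lag < (QdF.past Φ Ψ : ℕ∞))
    (hΨ : Ψ.tilde.PosSemidef) :
    ((∀ (l : Fin (Lplus + 1)) (z : Fin r → ℝ),
        0 ≤ dotProduct z (((window F l).transpose *
          (QdF.supplyHat Φ Ψ - QdF.nablaHat Φ Ψ) * window F l).mulVec z)) →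
      IsDissipative B Φ Ψ) ∧
    ∀ h : Lplus = 0,
      ((∀ (l : Fin (Lplus + 1)) (z : Fin r → ℝ),
        0 ≤ dotProduct z (((window F l).transpose *
          (QdF.supplyHat Φ Ψ - QdF.nablaHat Φ Ψ) * window F l).mulVec z)) ↔
      ((castRows (n := QdF.past Φ Ψ + 1) (by rw [h]) F).transpose *
        (QdF.supplyHat Φ Ψ - QdF.nablaHat Φ Ψ) *
        castRows (n := QdF.past Φ Ψ + 1) (by rw [h]) F).PosSemidef) := by
  constructor
  · intro h
    refine isDissipative_of_forall_eval (fun w _ k hk => QdF.eval_nonneg hΨ w hk) ?_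
    intro w hw k hk
    obtain ⟨a, rfl⟩ := Nat.exists_eq_add_of_le' hk
    -- Shifting by $a=k-L^-$ moves the window ending at $k$ to the start.
    set v : ℕ → Fin d → ℝ := fun i => w (i + a) with hv
    have hvB : v ∈ B := hB.timeInvariant.shift_mem hw a
    obtain ⟨z, hz⟩ : stack (Behavior.seg v 0 (QdF.past Φ Ψ + Lplus + 1)) ∈
        (LinearMap.range F.mulVecLin : Set _) :=
      hF ▸ Set.mem_image_of_mem _ (Set.mem_image_of_mem _ hvB)
    have hwin : (window F 0).mulVec z = stack (Behavior.seg v 0 (QdF.past Φ Ψ + 1)) := by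
      funext p
      have := congrFun hz (⟨p.1, by omega⟩, p.2)
      simpa [window, Matrix.mulVec, dotProduct, stack, Behavior.seg] using this
    have hquad : 0 ≤ TrajMatrix.quad (QdF.supplyHat Φ Ψ - QdF.nablaHat Φ Ψ) v 0 := by
      have := h 0 z
      rwa [dotProduct_congruence_mulVec, hwin] at this
    have hΦ : Φ.order ≤ QdF.past Φ Ψ := le_max_left _ _
    have hΨ' : Ψ.order + 1 ≤ QdF.past Φ Ψ := le_max_right _ _
    rw [TrajMatrix.quad_sub, QdF.quad_supplyHat, QdF.quad_nablaHat, zero_add, hv,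
      QdF.eval_shift Φ w a hΦ, QdF.eval_shift Ψ w a (by omega),
      QdF.eval_shift Ψ w a (by omega)] at hquad
    rw [add_comm a, show QdF.past Φ Ψ + a - 1 = QdF.past Φ Ψ - 1 + a by omega]
    linarith
  · rintro rfl
    rw [(QdF.isSymm_supplyHat_sub_nablaHat Φ Ψ).posSemidef_congruence_iff]
    -- For $L^+=0$ the only window is all of $\mathcal{F}$.
    have hwin : ∀ l : Fin (0 + 1), window (m := QdF.past Φ Ψ) (n := 0) F l =
        castRows (n := QdF.past Φ Ψ + 1) (by simp) F := by
      intro l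
      obtain rfl : l = 0 := Subsingleton.elim (α := Fin 1) _ _
      ext i j
      simp [window, castRows, Fin.cast]
    simp only [hwin, forall_const]
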